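/- Let $\mu$ be a Borel probability measure on $\mathbb R^d$ with closed support $D$, write $\|f\|_\infty=\sup_{x\in D}|f(x)|$, and let $V$ be a space of complex-valued functions in $L^2_\mu$ (genuine functions, defined at every point) of dimension $N\ge 1$, with an orthonormal basis $v_1,\dots,v_N\in V$ for $\langle f,g\rangle_\mu=\int f\bar g\,d\mu$. Put $$K(x,x)=\sum_{i=1}^N|v_i(x)|^2,\qquad K_\mu(V)=\sup_{x\in D}K(x,x),\qquad \lambda(x)=\frac{N}{K(x,x)},\qquad d\mu_V=\frac{1}{N}K(x,x)\,d\mu,$$ and $W=\{\sqrt{\lambda}\,v: v\in V\}$, where $\sqrt\lambda\,v$ is taken to be $0$ at points where $K(x,x)=0$ (there every $v\in V$ vanishes). Assume $K_\mu(V)<\infty$. Let $r>0$, $0<\delta<1$, let $M\ge 2$ be an integer, let $X_1,\dots,X_M$ be i.i.d. random points of $\mathbb R^d$, and write $\|f\|_{\infty,\mathcal A}=\max_{1\le m\le M}|f(X_m)|$. 1. If the $X_m$ have law $\mu$ and $\dfrac{M}{\log M}\ge\dfrac{3(1+r)}{\delta^2}K_\mu(V)$, then with probability at least $1-2M^{-r}$,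 $$\|v\|_\infty\le\sqrt{\frac{K_\mu(V)}{1-\delta}}\;\|v\|_{\infty,\mathcal A}\qquad\text{for all }v\in V.$$ 2. If the $X_m$ have law $\mu_V$ and $\dfrac{M}{\log M}\ge\dfrac{3(1+r)}{\delta^2}N$, then with probability at least $1-2M^{-r}$, $$\|w\|_\infty\le\sqrt{\frac{N}{1-\delta}}\;\|w\|_{\infty,\mathcal A}\qquad\text{for all }w\in W.$$ 3. If, moreover, $V$ contains a function that equals $1$ on $D$, the $X_m$ have law $\mu_V$ and $\dfrac{M}{\log M}\ge\dfrac{3(1+r)}{\delta^2}N$, then with probability at least $1-2M^{-r}$, $$\|v\|_\infty\le\sqrt{\frac{N\,K_\mu(V)}{1-\delta}}\;\|v\|_{\infty,\mathcal A}\qquad\text{for all }v\in V.$$ -/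

import Mathlib

open MeasureTheory ProbabilityTheory

noncomputable section

namespace RandomMesh

/-- `v 0, …, v (N - 1)` is an orthonormal basis, for the inner product
`⟨f, g⟩_μ = ∫ f conj(g) dμ`, of the space `V` of square-integrable functions. Elements of `V` are
functions with values at every point (they are sampled), and they are square-integrable because
they are linear combinations of the `v i`. Orthonormality makes the `v i` linearly independent,
so `V` has dimension `N`. -/
structure IsOrthonormalBasis {d N : ℕ} (μ : Measure (EuclideanSpace ℝ (Fin d)))
    (V : Submodule ℂ (EuclideanSpace ℝ (Fin d) → ℂ))
    (v : Fin N → EuclideanSpace ℝ (Fin d) → ℂ) : Prop where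
  memLp : ∀ i, MemLp (v i) 2 μ
  orthonormal : ∀ i j, ∫ x, v i x * (starRingEnd ℂ) (v j x) ∂μ = if i = j then 1 else 0
  span_eq : Submodule.span ℂ (Set.range v) = V

/-- The diagonal `K(x, x) = ∑ i, |v i x|²` of the reproducing kernel. -/
def kernelDiag {d N : ℕ} (v : Fin N → EuclideanSpace ℝ (Fin d) → ℂ)
    (x : EuclideanSpace ℝ (Fin d)) : ℝ :=
  ∑ i, ‖v i x‖ ^ 2

/-- `sup_{x ∈ D} |f x|`, where `D` is the closed support of `μ`. It is only meant for functions
that are bounded on `D`. -/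
def supNorm {d : ℕ} {F : Type*} [Norm F] (μ : Measure (EuclideanSpace ℝ (Fin d)))
    (f : EuclideanSpace ℝ (Fin d) → F) : ℝ :=
  ⨆ x : μ.support, ‖f x‖

/-- `max_m |f (x m)|` over the points `x m` of a finite mesh. -/
def discreteSupNorm {d M : ℕ} (x : Fin M → EuclideanSpace ℝ (Fin d))
    (f : EuclideanSpace ℝ (Fin d) → ℂ) : ℝ :=
  ⨆ m, ‖f (x m)‖

/-- The Bernstein–Markov factor `K_μ(V) = sup_{x ∈ D} K(x, x)`. -/
def bernsteinMarkov {d N : ℕ} (μ : Measure (EuclideanSpace ℝ (Fin d)))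
    (v : Fin N → EuclideanSpace ℝ (Fin d) → ℂ) : ℝ :=
  supNorm μ (kernelDiag v)

/-- The normalized Christoffel function `λ(x) = N / K(x, x)`. At a point where `K(x, x) = 0`
every element of `V` vanishes, and the value is irrelevant: it enters only through
`√λ · u` with `u ∈ V`, which is `0` there. -/
def christoffel {d N : ℕ} (v : Fin N → EuclideanSpace ℝ (Fin d) → ℂ)
    (x : EuclideanSpace ℝ (Fin d)) : ℝ :=
  N / kernelDiag v x

/-- The weighted space `W = √λ V`. -/
def weightedSpace {d N : ℕ} (V : Submodule ℂ (EuclideanSpace ℝ (Fin d) → ℂ))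
    (v : Fin N → EuclideanSpace ℝ (Fin d) → ℂ) : Set (EuclideanSpace ℝ (Fin d) → ℂ) :=
  {w | ∃ u ∈ V, w = fun x => (Real.sqrt (christoffel v x) : ℂ) * u x}

/-- The `V`-induced measure `dμ_V = (K(x, x) / N) dμ`. -/
def inducedMeasure {d N : ℕ} (μ : Measure (EuclideanSpace ℝ (Fin d)))
    (v : Fin N → EuclideanSpace ℝ (Fin d) → ℂ) : Measure (EuclideanSpace ℝ (Fin d)) :=
  μ.withDensity (fun x => ENNReal.ofReal (kernelDiag v x / N))

end RandomMesh

end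

namespace RandomMesh

/-! Everything reduces to a lower bound for the smallest eigenvalue of a sampled Gram matrix. If `f
1, …, f N` are orthonormal for `ν` and `∑ |f i|² ≤ κ`, the rank-one matrices `outer (f (X m))` are
independent, positive, of norm at most `κ`, with mean the identity. With high probability their sum
is at least `(1 - δ) M` times the identity, so a combination with coefficients `c` satisfies `(1 -
δ) M ‖c‖² ≤ ∑ |·|² ≤ M max |·|²`. Cauchy–Schwarz, `|∑ c i f i(x)|² ≤ κ ‖c‖²`, then bounds the values
on the support.

The eigenvalue bound is a matrix Chernoff argument that avoids Golden–Thompson and Lieb: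
`traceExp_sub_outer_le` controls how the trace exponential changes when one sample is subtracted,
and averaging multiplies it by at most `q = 1 - θ (1 - 3κθ/4)`. After `M` steps, Markov's inequality
gives the failure bound `N e^{θs} q^M` with `s = (1 - δ) M`.

Part 1 takes `ν = μ`, `f = v`, `κ = K_μ(V)`. For `μ_V` the functions are `√λ v i`, orthonormal with
`κ = N`. Part 3 returns to unweighted functions through `λ ≤ N` on the support, which follows from
`K ≥ 1` there. -/

/-! ### Scalar inequalities for the exponential. -/

theorem exp_mul_one_sub_half_le {y : ℝ} (hy : 0 ≤ y) :
    Real.exp y * (1 - y / 2) ≤ 1 + y / 2 := by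
  have hd : ∀ x : ℝ, HasDerivAt (fun y : ℝ => 1 + y / 2 - Real.exp y * (1 - y / 2))
      (1 / 2 - (Real.exp x * (1 - x / 2) + Real.exp x * (-(1 / 2)))) x := fun x =>
    (((hasDerivAt_id x).div_const 2).const_add 1).sub
      ((Real.hasDerivAt_exp x).mul (((hasDerivAt_id x).div_const 2).const_sub 1))
  have hmono : Monotone (fun y : ℝ => 1 + y / 2 - Real.exp y * (1 - y / 2)) := by
    refine monotone_of_deriv_nonneg (fun x => (hd x).differentiableAt) fun x => ?_
    rw [(hd x).deriv]
    have h := mul_le_mul_of_nonneg_left (Real.one_sub_le_exp_neg x) (Real.exp_pos x).le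
    rw [← Real.exp_add, add_neg_cancel, Real.exp_zero] at h
    linarith
  have := hmono hy
  simp only [zero_div, Real.exp_zero] at this
  linarith

/-- For `x ≥ 0` the Taylor bound `1 - x + x²/2` already suffices. For `x = -y ≤ 0`, multiply `e^y (1
- y/2) ≤ 1 + y/2` by `1 + y/2`; the last term of the statement absorbs the resulting `y²/4 · e^y`.
-/
theorem exp_neg_le_quadratic (x : ℝ) :
    Real.exp (-x) ≤ 1 - x + x ^ 2 / 2 + x ^ 2 / 4 * Real.exp (-x) := by
  rcases le_total 0 x with hx | hx
  · have h := Real.quadratic_le_exp_of_nonneg hx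
    have h1 := exp_mul_one_sub_half_le hx
    have h2 : Real.exp x * Real.exp (-x) = 1 := by rw [← Real.exp_add]; simp
    have h3 := Real.exp_pos (-x)
    have h4 : Real.exp (-x) ≤ 1 - x + x ^ 2 / 2 := by
      have h5 : (1 - x + x ^ 2 / 2) * (1 + x + x ^ 2 / 2) = 1 + x ^ 4 / 4 := by ring
      have h6 : 0 < 1 - x + x ^ 2 / 2 := by nlinarith [sq_nonneg (x - 1)]
      have h7 : 1 ≤ (1 - x + x ^ 2 / 2) * Real.exp x := by
        nlinarith [mul_le_mul_of_nonneg_left h h6.le, sq_nonneg (x ^ 2)]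
      calc Real.exp (-x) = 1 * Real.exp (-x) := (one_mul _).symm
        _ ≤ (1 - x + x ^ 2 / 2) * Real.exp x * Real.exp (-x) := by gcongr
        _ = _ := by rw [mul_assoc, h2, mul_one]
    have : 0 ≤ x ^ 2 / 4 * Real.exp (-x) := by positivity
    linarith
  · have h := exp_mul_one_sub_half_le (neg_nonneg.2 hx)
    have h1 := mul_le_mul_of_nonneg_right h (by linarith : (0 : ℝ) ≤ 1 + -x / 2)
    nlinarith [sq_nonneg x]

theorem exp_le_exp_trapezoid (b c : ℝ) :
    Real.exp c ≤ Real.exp b - (b - c) * Real.exp b + (b - c) ^ 2 / 2 * Real.exp b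
      + (b - c) ^ 2 / 4 * Real.exp c := by
  have h := mul_le_mul_of_nonneg_right (exp_neg_le_quadratic (b - c)) (Real.exp_pos b).le
  have h1 : Real.exp (-(b - c)) * Real.exp b = Real.exp c := by rw [← Real.exp_add]; ring_nf
  have h2 : (1 - (b - c) + (b - c) ^ 2 / 2 + (b - c) ^ 2 / 4 * Real.exp (-(b - c))) * Real.exp b
    = Real.exp b - (b - c) * Real.exp b + (b - c) ^ 2 / 2 * Real.exp b
      + (b - c) ^ 2 / 4 * (Real.exp (-(b - c)) * Real.exp b) := by ring
  rw [h2, h1] at h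
  exact h

/-! ### Trace inequalities for exponentials of Hermitian matrices. -/

section Trace

variable {n : Type*} [Fintype n] [DecidableEq n]

/-- The matrix `U diag(p) U*`. -/
def conjDiag (U : Matrix n n ℂ) (p : n → ℝ) : Matrix n n ℂ :=
  U * Matrix.diagonal (fun i => (p i : ℂ)) * U.conjTranspose

theorem conjDiag_mul {U : Matrix n n ℂ} (hU : U.conjTranspose * U = 1) (p q : n → ℝ) :
    conjDiag U p * conjDiag U q = conjDiag U (p * q) := by
  unfold conjDiag
  have : U * Matrix.diagonal (fun i => (p i : ℂ)) * U.conjTranspose *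
      (U * Matrix.diagonal (fun i => (q i : ℂ)) * U.conjTranspose) =
      U * Matrix.diagonal (fun i => (p i : ℂ)) * (U.conjTranspose * U) *
        Matrix.diagonal (fun i => (q i : ℂ)) * U.conjTranspose := by
    simp only [Matrix.mul_assoc]
  rw [this, hU, Matrix.mul_one, Matrix.mul_assoc U, Matrix.diagonal_mul_diagonal]
  simp

theorem conjDiag_one {U : Matrix n n ℂ} (hU : U * U.conjTranspose = 1) :
    conjDiag U 1 = 1 := by
  simp [conjDiag, hU]

/-- The weights are the squared overlaps of the columns of `U` and `W`. Being nonnegative, they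
carry scalar inequalities in pairs of eigenvalues over to traces, even for matrices that do not
commute. -/
theorem trace_conjDiag_mul_conjDiag (U W : Matrix n n ℂ) (p q : n → ℝ) :
    (Matrix.trace (conjDiag U p * conjDiag W q)).re =
      ∑ i, ∑ j, p i * q j * Complex.normSq ((U.conjTranspose * W) i j) := by
  have : conjDiag U p * conjDiag W q = U * (Matrix.diagonal (fun i => (p i : ℂ)) *
      (U.conjTranspose * W) * Matrix.diagonal (fun i => (q i : ℂ)) * W.conjTranspose) := by
    simp only [conjDiag, Matrix.mul_assoc]
  rw [this, Matrix.trace_mul_comm, Matrix.mul_assoc _ W.conjTranspose,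
    show W.conjTranspose * U = (U.conjTranspose * W).conjTranspose by simp]
  generalize U.conjTranspose * W = G
  simp only [Matrix.trace, Matrix.diag_apply, Matrix.mul_apply (N := G.conjTranspose),
    Matrix.mul_diagonal, Matrix.diagonal_mul, Matrix.conjTranspose_apply, Complex.re_sum]
  refine Finset.sum_congr rfl fun i _ => Finset.sum_congr rfl fun j _ => ?_
  have : (p i : ℂ) * G i j * q j * star (G i j) = ((p i * q j * Complex.normSq (G i j) : ℝ) : ℂ) := by
    push_cast
    rw [← Complex.mul_conj]
    simp only [RCLike.star_def]
    ring
  rw [this, Complex.ofReal_re]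

theorem exists_conjDiag {B : Matrix n n ℂ} (hB : B.IsHermitian) :
    ∃ (U : Matrix n n ℂ) (b : n → ℝ), U.conjTranspose * U = 1 ∧ U * U.conjTranspose = 1 ∧
      B = conjDiag U b ∧ NormedSpace.exp B = conjDiag U (fun i => Real.exp (b i)) := by
  have h1 : (hB.eigenvectorUnitary : Matrix n n ℂ).conjTranspose * hB.eigenvectorUnitary = 1 :=
    Matrix.mem_unitaryGroup_iff'.1 hB.eigenvectorUnitary.2
  have h2 : (hB.eigenvectorUnitary : Matrix n n ℂ) *
      (hB.eigenvectorUnitary : Matrix n n ℂ).conjTranspose = 1 :=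
    Matrix.mem_unitaryGroup_iff.1 hB.eigenvectorUnitary.2
  have h3 : B = conjDiag hB.eigenvectorUnitary hB.eigenvalues := by
    conv_lhs => rw [hB.spectral_theorem]
    rfl
  refine ⟨hB.eigenvectorUnitary, hB.eigenvalues, h1, h2, h3, ?_⟩
  conv_lhs => rw [h3]
  have h4 : (hB.eigenvectorUnitary : Matrix n n ℂ)⁻¹ =
      (hB.eigenvectorUnitary : Matrix n n ℂ).conjTranspose := Matrix.inv_eq_left_inv h1
  unfold conjDiag
  rw [← h4, Matrix.exp_conj _ _ (IsUnit.of_mul_eq_one _ h2), Matrix.exp_diagonal]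
  congr 3
  ext i
  rw [Pi.coe_exp, Complex.ofReal_exp, Complex.exp_eq_exp_ℂ]

/-- The trace of the matrix exponential, as a real number. -/
noncomputable def traceExp (B : Matrix n n ℂ) : ℝ := (Matrix.trace (NormedSpace.exp B)).re

/-- Every trace here is a double sum over eigenvalues `b i` of `B` and `c j` of `C` with the same
overlap weights. The first claim is then `exp_le_exp_trapezoid` termwise, the second the
monotonicity of the exponential. -/
theorem trace_exp_le {B C : Matrix n n ℂ} (hB : B.IsHermitian) (hC : C.IsHermitian) :
    traceExp C ≤ traceExp B - (Matrix.trace ((B - C) * NormedSpace.exp B)).re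
        + (Matrix.trace ((B - C) * (B - C) * NormedSpace.exp B)).re / 2
        + (Matrix.trace ((B - C) * (B - C) * NormedSpace.exp C)).re / 4 ∧
      (Matrix.trace ((B - C) * NormedSpace.exp C)).re ≤
        (Matrix.trace ((B - C) * NormedSpace.exp B)).re := by
  obtain ⟨U, b, hU, hU', hb, hbe⟩ := exists_conjDiag hB
  obtain ⟨W, c, hW, hW', hc, hce⟩ := exists_conjDiag hC
  unfold traceExp
  rw [hbe, hce]
  set β : n → ℝ := fun i => Real.exp (b i) with hβ
  set γ : n → ℝ := fun i => Real.exp (c i) with hγ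
  have T := trace_conjDiag_mul_conjDiag U W
  have oneU := conjDiag_one hU'
  have oneW := conjDiag_one hW'
  have e1 : (Matrix.trace (conjDiag U β)).re =
      ∑ i, ∑ j, β i * 1 * Complex.normSq ((U.conjTranspose * W) i j) := by
    rw [← mul_one (conjDiag U β), ← oneW, T]; rfl
  have e2 : (Matrix.trace (conjDiag W γ)).re =
      ∑ i, ∑ j, 1 * γ j * Complex.normSq ((U.conjTranspose * W) i j) := by
    rw [← one_mul (conjDiag W γ), ← oneU, T]; rfl
  have e3 : (Matrix.trace ((B - C) * conjDiag U β)).re =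
      ∑ i, ∑ j, (b i - c j) * β i * Complex.normSq ((U.conjTranspose * W) i j) := by
    have : Matrix.trace ((B - C) * conjDiag U β) =
        Matrix.trace (conjDiag U (b * β) * conjDiag W 1)
          - Matrix.trace (conjDiag U β * conjDiag W c) := by
      rw [sub_mul, Matrix.trace_sub, Matrix.trace_mul_comm C, oneW, mul_one, ← conjDiag_mul hU,
        ← hb, ← hc]
    rw [this, Complex.sub_re, T, T]
    simp only [← Finset.sum_sub_distrib]
    refine Finset.sum_congr rfl fun i _ => Finset.sum_congr rfl fun j _ => ?_
    simp only [Pi.mul_apply, Pi.one_apply]; ring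
  have e4 : (Matrix.trace ((B - C) * conjDiag W γ)).re =
      ∑ i, ∑ j, (b i - c j) * γ j * Complex.normSq ((U.conjTranspose * W) i j) := by
    have : Matrix.trace ((B - C) * conjDiag W γ) =
        Matrix.trace (conjDiag U b * conjDiag W γ)
          - Matrix.trace (conjDiag U 1 * conjDiag W (c * γ)) := by
      rw [sub_mul, Matrix.trace_sub, oneU, one_mul, ← conjDiag_mul hW, ← hb, ← hc]
    rw [this, Complex.sub_re, T, T]
    simp only [← Finset.sum_sub_distrib]
    refine Finset.sum_congr rfl fun i _ => Finset.sum_congr rfl fun j _ => ?_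
    simp only [Pi.mul_apply, Pi.one_apply]; ring
  have e5 : (Matrix.trace ((B - C) * (B - C) * conjDiag U β)).re =
      ∑ i, ∑ j, (b i - c j) ^ 2 * β i * Complex.normSq ((U.conjTranspose * W) i j) := by
    -- After expanding the square, cyclicity of the trace brings each term to the form (function of
    -- `B`) times (function of `C`).
    have : Matrix.trace ((B - C) * (B - C) * conjDiag U β) =
        Matrix.trace (conjDiag U (b * (b * β)) * conjDiag W 1)
          - Matrix.trace (conjDiag U (β * b) * conjDiag W c)
          - Matrix.trace (conjDiag U (b * β) * conjDiag W c)
          + Matrix.trace (conjDiag U β * conjDiag W (c * c)) := by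
      rw [oneW, mul_one, ← conjDiag_mul hU, ← conjDiag_mul hU, ← conjDiag_mul hU,
        ← conjDiag_mul hW, ← hb, ← hc, Matrix.trace_mul_comm _ (C * C),
        Matrix.trace_mul_comm (B * _) C, Matrix.mul_assoc (conjDiag U β) B C,
        Matrix.trace_mul_comm (conjDiag U β), ← Matrix.trace_sub, ← Matrix.trace_sub,
        ← Matrix.trace_add]
      congr 1
      noncomm_ring
    rw [this, Complex.add_re, Complex.sub_re, Complex.sub_re, T, T, T, T]
    simp only [← Finset.sum_sub_distrib, ← Finset.sum_add_distrib]
    refine Finset.sum_congr rfl fun i _ => Finset.sum_congr rfl fun j _ => ?_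
    simp only [Pi.mul_apply, Pi.one_apply]; ring
  have e6 : (Matrix.trace ((B - C) * (B - C) * conjDiag W γ)).re =
      ∑ i, ∑ j, (b i - c j) ^ 2 * γ j * Complex.normSq ((U.conjTranspose * W) i j) := by
    have : Matrix.trace ((B - C) * (B - C) * conjDiag W γ) =
        Matrix.trace (conjDiag U (b * b) * conjDiag W γ)
          - Matrix.trace (conjDiag U b * conjDiag W (c * γ))
          - Matrix.trace (conjDiag U b * conjDiag W (γ * c))
          + Matrix.trace (conjDiag U 1 * conjDiag W (c * (c * γ))) := by
      rw [oneU, one_mul, ← conjDiag_mul hU, ← conjDiag_mul hW, ← conjDiag_mul hW,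
        ← conjDiag_mul hW, ← hb, ← hc, ← Matrix.mul_assoc B _ C,
        Matrix.trace_mul_comm (B * conjDiag W γ) C, ← Matrix.trace_sub, ← Matrix.trace_sub,
        ← Matrix.trace_add, ← conjDiag_mul hW, ← hc]
      congr 1
      noncomm_ring
    rw [this, Complex.add_re, Complex.sub_re, Complex.sub_re, T, T, T, T]
    simp only [← Finset.sum_sub_distrib, ← Finset.sum_add_distrib]
    refine Finset.sum_congr rfl fun i _ => Finset.sum_congr rfl fun j _ => ?_
    simp only [Pi.mul_apply, Pi.one_apply]; ring
  rw [e1, e2, e3, e4, e5, e6]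
  constructor
  · simp only [← Finset.sum_sub_distrib, ← Finset.sum_add_distrib, Finset.sum_div]
    refine Finset.sum_le_sum fun i _ => Finset.sum_le_sum fun j _ => ?_
    have h := mul_le_mul_of_nonneg_right (exp_le_exp_trapezoid (b i) (c j))
      (Complex.normSq_nonneg ((U.conjTranspose * W) i j))
    simp only [hβ, hγ]
    linarith
  · refine Finset.sum_le_sum fun i _ => Finset.sum_le_sum fun j _ => ?_
    refine mul_le_mul_of_nonneg_right ?_ (Complex.normSq_nonneg _)
    rcases le_total (b i) (c j) with h | h
    · exact mul_le_mul_of_nonpos_left (Real.exp_le_exp.2 h) (sub_nonpos.2 h)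
    · exact mul_le_mul_of_nonneg_left (Real.exp_le_exp.2 h) (sub_nonneg.2 h)

/-- The rank-one matrix `x x*`. -/
def outer (x : n → ℂ) : Matrix n n ℂ := Matrix.vecMulVec x (star x)

omit [Fintype n] [DecidableEq n] in
theorem isHermitian_outer (x : n → ℂ) : (outer x).IsHermitian := by
  ext i j
  simp [outer, Matrix.vecMulVec_apply, mul_comm]

omit [Fintype n] [DecidableEq n] in
theorem isHermitian_smul_outer (θ : ℝ) (x : n → ℂ) : ((θ : ℂ) • outer x).IsHermitian := by
  rw [Matrix.IsHermitian, Matrix.conjTranspose_smul, (isHermitian_outer x).eq]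
  simp

omit [DecidableEq n] in
theorem outer_mul_outer (x : n → ℂ) :
    outer x * outer x = ((∑ i, ‖x i‖ ^ 2 : ℝ) : ℂ) • outer x := by
  have : (star x ⬝ᵥ x) = ((∑ i, ‖x i‖ ^ 2 : ℝ) : ℂ) := by
    simp only [dotProduct, Pi.star_apply, RCLike.star_def, Complex.conj_mul', Complex.ofReal_sum,
      Complex.ofReal_pow]
  rw [outer, Matrix.vecMulVec_mul_vecMulVec, this]
  ext i j
  simp [Matrix.vecMulVec_apply, mul_left_comm]

theorem re_dotProduct_conjDiag (U : Matrix n n ℂ) (p : n → ℝ) (x : n → ℂ) :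
    (star x ⬝ᵥ (conjDiag U p).mulVec x).re =
      ∑ i, p i * Complex.normSq (U.conjTranspose.mulVec x i) := by
  have : star x ⬝ᵥ (conjDiag U p).mulVec x = star (U.conjTranspose.mulVec x) ⬝ᵥ
      (Matrix.diagonal (fun i => (p i : ℂ))).mulVec (U.conjTranspose.mulVec x) := by
    rw [conjDiag, ← Matrix.mulVec_mulVec, ← Matrix.mulVec_mulVec, Matrix.star_mulVec,
      Matrix.conjTranspose_conjTranspose, Matrix.dotProduct_mulVec]
  rw [this, dotProduct, Complex.re_sum]
  refine Finset.sum_congr rfl fun i _ => ?_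
  rw [Matrix.mulVec_diagonal, Complex.normSq_apply]
  simp
  ring

omit [DecidableEq n] in
theorem trace_outer_mul (x : n → ℂ) (A : Matrix n n ℂ) :
    Matrix.trace (outer x * A) = star x ⬝ᵥ A.mulVec x := by
  rw [outer, Matrix.trace_mul_comm, Matrix.mul_vecMulVec, Matrix.trace_vecMulVec,
    dotProduct_comm]

theorem trace_outer_mul_exp_nonneg (x : n → ℂ) {B : Matrix n n ℂ} (hB : B.IsHermitian) :
    0 ≤ (Matrix.trace (outer x * NormedSpace.exp B)).re := by
  obtain ⟨U, b, -, -, -, hbe⟩ := exists_conjDiag hB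
  rw [trace_outer_mul, hbe, re_dotProduct_conjDiag]
  exact Finset.sum_nonneg fun i _ => mul_nonneg (Real.exp_pos _).le (Complex.normSq_nonneg _)

theorem traceExp_pos [Nonempty n] {B : Matrix n n ℂ} (hB : B.IsHermitian) : 0 < traceExp B := by
  obtain ⟨U, b, hU, hU', -, hbe⟩ := exists_conjDiag hB
  rw [traceExp, hbe, conjDiag, Matrix.trace_mul_comm, ← Matrix.mul_assoc, hU, one_mul,
    Matrix.trace_diagonal, Complex.re_sum]
  exact Finset.sum_pos (fun i _ => by rw [Complex.ofReal_re]; exact Real.exp_pos (b i)) Finset.univ_nonempty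

/-- For a rank-one step, `(B - C)²` is `θ ‖x‖²` times `B - C`, so the second-order terms of
`trace_exp_le` are multiples of the first-order ones. The factor `3/4` is `1/2 + 1/4`, once the term
with `exp C` is replaced by the one with `exp B`. -/
theorem traceExp_sub_outer_le {B : Matrix n n ℂ} (hB : B.IsHermitian) (x : n → ℂ) {θ κ : ℝ}
    (hθ : 0 ≤ θ) (hx : ∑ i, ‖x i‖ ^ 2 ≤ κ) :
    traceExp (B - (θ : ℂ) • outer x) ≤ traceExp B -
      θ * (1 - 3 / 4 * (κ * θ)) * (Matrix.trace (outer x * NormedSpace.exp B)).re := by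
  have hC : (B - (θ : ℂ) • outer x).IsHermitian := hB.sub (isHermitian_smul_outer θ x)
  obtain ⟨h1, h2⟩ := trace_exp_le hB hC
  have g1 := trace_outer_mul_exp_nonneg x hB
  have g2 := trace_outer_mul_exp_nonneg x hC
  simp only [sub_sub_cancel, Matrix.smul_mul, Matrix.mul_smul, outer_mul_outer, smul_smul,
    Matrix.trace_smul, smul_eq_mul] at h1 h2
  simp only [← Complex.ofReal_mul, Complex.re_ofReal_mul] at h1 h2
  set s := ∑ i, ‖x i‖ ^ 2
  set g := (Matrix.trace (outer x * NormedSpace.exp B)).re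
  set g' := (Matrix.trace (outer x * NormedSpace.exp (B - (θ : ℂ) • outer x))).re
  have hs : 0 ≤ s := Finset.sum_nonneg fun i _ => by positivity
  have hκ : 0 ≤ κ := hs.trans hx
  have k1 : θ * θ * s * g ≤ θ * θ * κ * g := by gcongr
  have k2 : θ * θ * s * g' ≤ θ * κ * (θ * g) := by
    calc θ * θ * s * g' = θ * s * (θ * g') := by ring
      _ ≤ θ * κ * (θ * g) := by gcongr
  linarith

/-- Each `e^{b i}` is at most the sum of all of them, so every eigenvalue is at most `t`. -/
theorem re_dotProduct_le_of_traceExp_lt {A : Matrix n n ℂ} (hA : A.IsHermitian) {t : ℝ}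
    (h : traceExp A < Real.exp t) (x : n → ℂ) :
    (star x ⬝ᵥ A.mulVec x).re ≤ t * ∑ i, ‖x i‖ ^ 2 := by
  obtain ⟨U, b, hU, hU', hb, hbe⟩ := exists_conjDiag hA
  rw [traceExp, hbe, conjDiag, Matrix.trace_mul_comm, ← Matrix.mul_assoc, hU, one_mul,
    Matrix.trace_diagonal, Complex.re_sum] at h
  simp only [Complex.ofReal_re] at h
  have hbt : ∀ i, b i ≤ t := fun i => by
    rw [← Real.exp_le_exp]
    exact (Finset.single_le_sum (f := fun i => Real.exp (b i))
      (fun j _ => (Real.exp_pos _).le) (Finset.mem_univ i)).trans h.le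
  have hn : ∑ i, ‖x i‖ ^ 2 = ∑ i, Complex.normSq (U.conjTranspose.mulVec x i) := by
    have := re_dotProduct_conjDiag U 1 x
    rw [conjDiag_one hU', Matrix.one_mulVec, dotProduct, Complex.re_sum] at this
    simp only [Pi.one_apply, one_mul] at this
    rw [← this]
    refine Finset.sum_congr rfl fun i _ => ?_
    rw [Pi.star_apply, RCLike.star_def, Complex.conj_mul', ← Complex.ofReal_pow, Complex.ofReal_re]
  rw [hb, re_dotProduct_conjDiag, hn, Finset.mul_sum]
  exact Finset.sum_le_sum fun i _ =>
    mul_le_mul_of_nonneg_right (hbt i) (Complex.normSq_nonneg _)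

theorem continuous_traceExp : Continuous (traceExp : Matrix n n ℂ → ℝ) := by
  have : Continuous (NormedSpace.exp : Matrix n n ℂ → Matrix n n ℂ) := by
    let _ : NormedRing (Matrix n n ℂ) := Matrix.linftyOpNormedRing
    let _ : NormedAlgebra ℂ (Matrix n n ℂ) := Matrix.linftyOpNormedAlgebra
    let _ : NormedAlgebra ℚ (Matrix n n ℂ) := NormedAlgebra.restrictScalars ℚ ℂ _
    exact NormedSpace.exp_continuous
  exact Complex.continuous_re.comp this.matrix_trace

end Trace

/-! ### Matrix Chernoff bound for independent rank-one samples. -/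

section Chernoff

variable {n : Type*} [Fintype n] {E : Type*} [MeasurableSpace E]

/-- A family of functions that is orthonormal for `∫ f conj(g) dν` and whose pointwise square sum
is at most `κ` almost everywhere. -/
structure IsBoundedOrthonormal [DecidableEq n] (ν : Measure E) (f : n → E → ℂ) (κ : ℝ) :
    Prop where
  aestronglyMeasurable : ∀ i, AEStronglyMeasurable (f i) ν
  sum_sq_le : ∀ᵐ x ∂ν, ∑ i, ‖f i x‖ ^ 2 ≤ κ
  orthonormal : ∀ i j, ∫ x, f i x * (starRingEnd ℂ) (f j x) ∂ν = if i = j then 1 else 0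

variable [DecidableEq n] {ν : Measure E} [IsProbabilityMeasure ν] {f : n → E → ℂ} {κ : ℝ}

theorem IsBoundedOrthonormal.memLp (hf : IsBoundedOrthonormal ν f κ) (i : n) :
    MemLp (f i) 2 ν := by
  refine MemLp.of_bound (hf.aestronglyMeasurable i) (Real.sqrt κ) ?_
  filter_upwards [hf.sum_sq_le] with x hx
  refine Real.le_sqrt_of_sq_le ((Finset.single_le_sum (f := fun i => ‖f i x‖ ^ 2)
    (fun j _ => by positivity) (Finset.mem_univ i)).trans hx)

theorem IsBoundedOrthonormal.integrable_mul_conj (hf : IsBoundedOrthonormal ν f κ) (i j : n) :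
    Integrable (fun x => f i x * (starRingEnd ℂ) (f j x)) ν :=
  (hf.memLp i).integrable_mul (hf.memLp j).star

theorem IsBoundedOrthonormal.card_le (hf : IsBoundedOrthonormal ν f κ) :
    (Fintype.card n : ℝ) ≤ κ := by
  have h1 : ∀ i, Integrable (fun x => ‖f i x‖ ^ 2) ν := fun i =>
    (memLp_two_iff_integrable_sq_norm (hf.aestronglyMeasurable i)).1 (hf.memLp i)
  have h2 : ∀ i, ∫ x, ‖f i x‖ ^ 2 ∂ν = 1 := fun i => by
    have := hf.orthonormal i i
    simp only [Complex.mul_conj', if_true] at this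
    simp only [← Complex.ofReal_pow] at this
    rw [integral_complex_ofReal] at this
    exact_mod_cast this
  have h3 : ∫ x, ∑ i, ‖f i x‖ ^ 2 ∂ν = Fintype.card n := by
    rw [integral_finsetSum _ fun i _ => h1 i]
    simp [h2]
  rw [← h3]
  calc _ ≤ ∫ _, κ ∂ν := integral_mono_ae (integrable_finsetSum _ fun i _ => h1 i)
        (integrable_const κ) hf.sum_sq_le
    _ = κ := by simp

/-- Orthonormality says that the mean of `outer (f x)` is the identity; this is that fact tested
against `A`. -/
theorem IsBoundedOrthonormal.integral_trace (hf : IsBoundedOrthonormal ν f κ)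
    (A : Matrix n n ℂ) :
    Integrable (fun x => (Matrix.trace (outer (fun i => f i x) * A)).re) ν ∧
      ∫ x, (Matrix.trace (outer (fun i => f i x) * A)).re ∂ν = (Matrix.trace A).re := by
  have h : ∀ x, Matrix.trace (outer (fun i => f i x) * A) =
      ∑ i, ∑ j, A i j * (f j x * (starRingEnd ℂ) (f i x)) := fun x => by
    rw [trace_outer_mul]
    simp only [dotProduct, Matrix.mulVec, Finset.mul_sum, Pi.star_apply, RCLike.star_def]
    refine Finset.sum_congr rfl fun i _ => Finset.sum_congr rfl fun j _ => ?_
    ring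
  have hi : ∀ i j, Integrable (fun x => A i j * (f j x * (starRingEnd ℂ) (f i x))) ν :=
    fun i j => (hf.integrable_mul_conj j i).const_mul _
  have hI : Integrable (fun x => Matrix.trace (outer (fun i => f i x) * A)) ν := by
    simp only [h]
    exact integrable_finsetSum _ fun i _ => integrable_finsetSum _ fun j _ => hi i j
  refine ⟨hI.re, ?_⟩
  have : ∫ x, (Matrix.trace (outer (fun i => f i x) * A)).re ∂ν =
      (∫ x, Matrix.trace (outer (fun i => f i x) * A) ∂ν).re := integral_re hI
  rw [this]
  congr 1
  simp only [h]
  rw [integral_finsetSum _ fun i _ => integrable_finsetSum _ fun j _ => hi i j, Matrix.trace]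
  refine Finset.sum_congr rfl fun i _ => ?_
  rw [integral_finsetSum _ fun j _ => hi i j]
  simp [integral_const_mul, hf.orthonormal]

theorem IsBoundedOrthonormal.lintegral_traceExp_sub_outer_le [Nonempty n]
    (hf : IsBoundedOrthonormal ν f κ) {B : Matrix n n ℂ} (hB : B.IsHermitian) {θ : ℝ}
    (hθ : 0 ≤ θ) :
    ∫⁻ x, ENNReal.ofReal (traceExp (B - (θ : ℂ) • outer (fun i => f i x))) ∂ν ≤
      ENNReal.ofReal ((1 - θ * (1 - 3 / 4 * (κ * θ))) * traceExp B) := by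
  obtain ⟨hI, hE⟩ := hf.integral_trace (NormedSpace.exp B)
  have hle : ∀ᵐ x ∂ν, traceExp (B - (θ : ℂ) • outer (fun i => f i x)) ≤ traceExp B -
      θ * (1 - 3 / 4 * (κ * θ)) *
        (Matrix.trace (outer (fun i => f i x) * NormedSpace.exp B)).re := by
    filter_upwards [hf.sum_sq_le] with x hx
    exact traceExp_sub_outer_le hB _ hθ hx
  have hpos : ∀ x, 0 ≤ traceExp (B - (θ : ℂ) • outer (fun i => f i x)) := fun x =>
    (traceExp_pos (hB.sub (isHermitian_smul_outer θ _))).le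
  calc _ ≤ ∫⁻ x, ENNReal.ofReal (traceExp B - θ * (1 - 3 / 4 * (κ * θ)) *
        (Matrix.trace (outer (fun i => f i x) * NormedSpace.exp B)).re) ∂ν :=
      lintegral_mono_ae (hle.mono fun x hx => ENNReal.ofReal_le_ofReal hx)
    _ = ENNReal.ofReal (∫ x, (traceExp B - θ * (1 - 3 / 4 * (κ * θ)) *
        (Matrix.trace (outer (fun i => f i x) * NormedSpace.exp B)).re) ∂ν) :=
      (ofReal_integral_eq_lintegral_ofReal ((integrable_const _).sub (hI.const_mul _))
        (hle.mono fun x hx => (hpos x).trans hx)).symm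
    _ = _ := by
      rw [integral_sub (integrable_const _) (hI.const_mul _), integral_const_mul, hE]
      simp only [integral_const, probReal_univ, one_smul, traceExp]
      congr 1
      ring

theorem IsBoundedOrthonormal.lintegral_traceExp_sub_sum_outer_le [Nonempty n]
    (hf : IsBoundedOrthonormal ν f κ) {θ : ℝ} (hθ : 0 ≤ θ)
    (hq : 0 ≤ 1 - θ * (1 - 3 / 4 * (κ * θ))) (M : ℕ) {B : Matrix n n ℂ} (hB : B.IsHermitian) :
    ∫⁻ x, ENNReal.ofReal (traceExp (B - ∑ m, (θ : ℂ) • outer (fun i => f i (x m))))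
        ∂(Measure.pi fun _ : Fin M => ν) ≤
      ENNReal.ofReal ((1 - θ * (1 - 3 / 4 * (κ * θ))) ^ M * traceExp B) := by
  induction M generalizing B with
  | zero => simp
  | succ M ih =>
    have hmp := (measurePreserving_piFinSuccAbove (fun _ : Fin (M + 1) => ν) 0).symm
    rw [← hmp.lintegral_comp_emb (MeasurableEquiv.measurableEmbedding _)]
    simp_rw [MeasurableEquiv.piFinSuccAbove_symm_apply, Fin.insertNthEquiv, Fin.sum_univ_succ]
    -- Only an inequality between the product and iterated integrals is needed, so measurability
    -- plays no role. The first sample is absorbed into `B`, which is why the induction generalizes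
    -- over `B`.
    refine (lintegral_prod_le _).trans ?_
    simp only [Equiv.coe_fn_mk, Fin.insertNth_zero, Fin.cons_zero, Fin.cons_succ, ← sub_sub]
    calc _ ≤ ∫⁻ x, ENNReal.ofReal ((1 - θ * (1 - 3 / 4 * (κ * θ))) ^ M) *
          ENNReal.ofReal (traceExp (B - (θ : ℂ) • outer (fun i => f i x))) ∂ν := by
          refine lintegral_mono fun x => ?_
          rw [← ENNReal.ofReal_mul (by positivity)]
          exact ih (hB.sub (isHermitian_smul_outer θ _))
      _ ≤ ENNReal.ofReal ((1 - θ * (1 - 3 / 4 * (κ * θ))) ^ M) *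
          ENNReal.ofReal ((1 - θ * (1 - 3 / 4 * (κ * θ))) * traceExp B) := by
          rw [lintegral_const_mul' _ _ ENNReal.ofReal_ne_top]
          gcongr
          exact hf.lintegral_traceExp_sub_outer_le hB hθ
      _ = _ := by
          rw [← ENNReal.ofReal_mul (by positivity)]
          congr 1
          ring

-- The form is evaluated at `star c` because `∑ c i y i` carries no conjugation.
omit [DecidableEq n] in
theorem re_dotProduct_smul_outer (θ : ℝ) (y c : n → ℂ) :
    (star (star c) ⬝ᵥ ((θ : ℂ) • outer y).mulVec (star c)).re = θ * ‖∑ i, c i * y i‖ ^ 2 := by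
  rw [Matrix.smul_mulVec, dotProduct_smul, smul_eq_mul, Complex.re_ofReal_mul, outer,
    Matrix.vecMulVec_mulVec, star_star]
  congr 1
  have : star y ⬝ᵥ star c = star (∑ i, c i * y i) := by
    simp [dotProduct, mul_comm]
  rw [this, dotProduct_smul]
  simp only [dotProduct, MulOpposite.smul_eq_mul_unop, MulOpposite.unop_op, RCLike.star_def,
    Complex.mul_conj', ← Complex.ofReal_pow, Complex.ofReal_re]

theorem IsBoundedOrthonormal.measure_exists_sum_sq_lt_le [Nonempty n]
    (hf : IsBoundedOrthonormal ν f κ) (hfm : ∀ i, Measurable (f i)) {θ s : ℝ} (hθ : 0 < θ)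
    (hq : 0 ≤ 1 - θ * (1 - 3 / 4 * (κ * θ))) (M : ℕ) :
    (Measure.pi fun _ : Fin M => ν) {x | ¬ ∀ c : n → ℂ,
        s * ∑ i, ‖c i‖ ^ 2 ≤ ∑ m, ‖∑ i, c i * f i (x m)‖ ^ 2} ≤
      ENNReal.ofReal (Real.exp (θ * s) * (1 - θ * (1 - 3 / 4 * (κ * θ))) ^ M *
        Fintype.card n) := by
  set F : (Fin M → E) → Matrix n n ℂ := fun x => 0 - ∑ m, (θ : ℂ) • outer (fun i => f i (x m))
    with hF
  have hFm : Measurable fun x => ENNReal.ofReal (traceExp (F x)) := by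
    have : Measurable fun x i j => F x i j := by
      refine measurable_pi_lambda _ fun i => measurable_pi_lambda _ fun j => ?_
      simp only [hF, Matrix.sub_apply, Matrix.sum_apply, Matrix.smul_apply, outer,
        Matrix.vecMulVec_apply, Pi.star_apply, RCLike.star_def]
      have := hfm i
      have := hfm j
      have hc : Measurable (starRingEnd ℂ) := Complex.continuous_conj.measurable
      fun_prop
    have hcont : Continuous fun A : n → n → ℂ => traceExp (Matrix.of A) := continuous_traceExp
    exact (hcont.measurable.comp this).ennreal_ofReal
  have hH : ∀ x, (F x).IsHermitian := fun x =>
    Matrix.isHermitian_zero.sub <| by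
      rw [Matrix.IsHermitian, Matrix.conjTranspose_sum]
      exact Finset.sum_congr rfl fun m _ => isHermitian_smul_outer θ _
  -- If the trace exponential of `F x` is below `e^{-θs}`, all eigenvalues of `F x` are at most
  -- `-θs`, which is the wanted lower bound on the Gram matrix.
  have hsub : {x | ¬ ∀ c : n → ℂ, s * ∑ i, ‖c i‖ ^ 2 ≤ ∑ m, ‖∑ i, c i * f i (x m)‖ ^ 2} ⊆
      {x | ENNReal.ofReal (Real.exp (-(θ * s))) ≤ ENNReal.ofReal (traceExp (F x))} := by
    intro x hx
    simp only [Set.mem_ofPred_eq] at hx ⊢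
    contrapose! hx
    intro c
    rw [ENNReal.ofReal_lt_ofReal_iff (Real.exp_pos _)] at hx
    have h := re_dotProduct_le_of_traceExp_lt (hH x) hx (star c)
    simp only [hF, zero_sub, Matrix.neg_mulVec, dotProduct_neg, Complex.neg_re,
      Matrix.sum_mulVec, dotProduct_sum, Complex.re_sum, re_dotProduct_smul_outer,
      ← Finset.mul_sum, Pi.star_apply, norm_star] at h
    refine le_of_mul_le_mul_left ?_ hθ
    linarith
  have hmarkov := mul_meas_ge_le_lintegral (μ := Measure.pi fun _ : Fin M => ν) hFm
    (ENNReal.ofReal (Real.exp (-(θ * s))))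
  have hint := hf.lintegral_traceExp_sub_sum_outer_le hθ.le hq M
    (B := 0) Matrix.isHermitian_zero
  have h0 : traceExp (0 : Matrix n n ℂ) = Fintype.card n := by
    simp [traceExp]
  rw [h0] at hint
  have key := (mul_le_mul_right (measure_mono (μ := Measure.pi fun _ : Fin M => ν) hsub) _).trans
    (hmarkov.trans hint)
  have hexp : ENNReal.ofReal (Real.exp (θ * s)) * ENNReal.ofReal (Real.exp (-(θ * s))) = 1 := by
    rw [← ENNReal.ofReal_mul (Real.exp_pos _).le, ← Real.exp_add]
    simp
  calc _ = ENNReal.ofReal (Real.exp (θ * s)) * (ENNReal.ofReal (Real.exp (-(θ * s))) *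
        (Measure.pi fun _ : Fin M => ν) {x | ¬ ∀ c : n → ℂ,
        s * ∑ i, ‖c i‖ ^ 2 ≤ ∑ m, ‖∑ i, c i * f i (x m)‖ ^ 2}) := by
        rw [← mul_assoc, hexp, one_mul]
    _ ≤ ENNReal.ofReal (Real.exp (θ * s)) * ENNReal.ofReal
        ((1 - θ * (1 - 3 / 4 * (κ * θ))) ^ M * Fintype.card n) := by gcongr
    _ = _ := by rw [← ENNReal.ofReal_mul (Real.exp_pos _).le, mul_assoc]

theorem chernoff_base_nonneg {κ δ : ℝ} (hκ : 1 ≤ κ) (hδ0 : 0 < δ) (hδ1 : δ < 1) :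
    0 ≤ 1 - 2 * δ / (3 * κ) * (1 - 3 / 4 * (κ * (2 * δ / (3 * κ)))) := by
  have hκ0 : 0 < κ := by linarith
  have h1 : 2 * δ / (3 * κ) ≤ 1 := by
    rw [div_le_one (by positivity)]
    linarith
  have h2 : 3 / 4 * (κ * (2 * δ / (3 * κ))) = δ / 2 := by
    field_simp
    norm_num
  rw [h2]
  have h3 : 0 ≤ 2 * δ / (3 * κ) := by positivity
  nlinarith

/-- The value `θ = 2δ/(3κ)` minimizes the exponent `M (-θδ + 3κθ²/4)`, with minimum `-δ²M/(3κ) ≤ -(1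
+ r) log M`. The dimension factor `N ≤ κ ≤ M` costs one power of `M`. -/
theorem chernoff_constant_le {N M : ℕ} {κ r δ : ℝ} (hN : 1 ≤ N) (hM : 2 ≤ M) (hNκ : N ≤ κ)
    (hr : 0 < r) (hδ0 : 0 < δ) (hδ1 : δ < 1)
    (h : 3 * (1 + r) / δ ^ 2 * κ ≤ M / Real.log M) :
    Real.exp (2 * δ / (3 * κ) * ((1 - δ) * M)) *
      (1 - 2 * δ / (3 * κ) * (1 - 3 / 4 * (κ * (2 * δ / (3 * κ))))) ^ M * N ≤
        (M : ℝ) ^ (-r) := by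
  have hN' : (1 : ℝ) ≤ N := by exact_mod_cast hN
  have hM' : (2 : ℝ) ≤ M := by exact_mod_cast hM
  have hκ : 1 ≤ κ := hN'.trans hNκ
  have hκ0 : 0 < κ := by linarith
  have hlog2 : (1 : ℝ) / 2 ≤ Real.log M := by
    have := Real.log_two_gt_d9
    have := Real.log_le_log (by norm_num) hM'
    linarith
  have hL : 0 < Real.log M := by linarith
  rw [le_div_iff₀ hL] at h
  have h' : 3 * (1 + r) * κ * Real.log M ≤ δ ^ 2 * M := by
    have := mul_le_mul_of_nonneg_left h (sq_nonneg δ)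
    have e : δ ^ 2 * (3 * (1 + r) / δ ^ 2 * κ * Real.log M) = 3 * (1 + r) * κ * Real.log M := by
      field_simp
    linarith
  have hNM : (N : ℝ) ≤ M := by
    have h1 : κ * (1 + r) * (1 / 2) ≤ κ * (1 + r) * Real.log M := by gcongr
    have h2 : δ ^ 2 * M ≤ 1 * M := by
      gcongr
      nlinarith
    nlinarith [mul_pos hκ0 hr]
  have hq0 := chernoff_base_nonneg hκ hδ0 hδ1
  have hq : (1 - 2 * δ / (3 * κ) * (1 - 3 / 4 * (κ * (2 * δ / (3 * κ))))) ^ M ≤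
      Real.exp (-(2 * δ / (3 * κ) * (1 - 3 / 4 * (κ * (2 * δ / (3 * κ)))) * M)) := by
    calc _ ≤ Real.exp (-(2 * δ / (3 * κ) * (1 - 3 / 4 * (κ * (2 * δ / (3 * κ)))))) ^ M := by
          gcongr
          exact Real.one_sub_le_exp_neg _
      _ = _ := by
          rw [← Real.exp_nat_mul]
          congr 1
          ring
  calc _ ≤ Real.exp (2 * δ / (3 * κ) * ((1 - δ) * M)) *
        Real.exp (-(2 * δ / (3 * κ) * (1 - 3 / 4 * (κ * (2 * δ / (3 * κ)))) * M)) * M := by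
        gcongr
    _ = Real.exp (-(δ ^ 2 * M / (3 * κ))) * M := by
        rw [← Real.exp_add]
        congr 2
        field_simp
        ring
    _ ≤ Real.exp (-((1 + r) * Real.log M)) * M := by
        gcongr
        rw [le_div_iff₀ (by positivity)]
        linarith
    _ = (M : ℝ) ^ (-r) := by
        rw [Real.rpow_def_of_pos (by linarith)]
        nth_rewrite 2 [← Real.exp_log (show (0 : ℝ) < M by linarith)]
        rw [← Real.exp_add]
        congr 1
        ring

/-- Lower matrix Chernoff bound for the sampled Gram matrix, stated for the quadratic form. -/
theorem IsBoundedOrthonormal.measure_exists_sum_sq_sample_lt_le [Nonempty n]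
    (hf : IsBoundedOrthonormal ν f κ) {M : ℕ} (hM : 2 ≤ M) {r δ : ℝ} (hr : 0 < r) (hδ0 : 0 < δ)
    (hδ1 : δ < 1) (h : 3 * (1 + r) / δ ^ 2 * κ ≤ M / Real.log M)
    {Ω : Type*} [MeasurableSpace Ω] {P : Measure Ω} [IsProbabilityMeasure P]
    {X : Fin M → Ω → E} (hX : iIndepFun X P) (hlaw : ∀ m, HasLaw (X m) ν P) :
    P {ω | ¬ ∀ c : n → ℂ, (1 - δ) * M * ∑ i, ‖c i‖ ^ 2 ≤
        ∑ m, ‖∑ i, c i * f i (X m ω)‖ ^ 2} ≤ ENNReal.ofReal ((M : ℝ) ^ (-r)) := by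
  -- Markov's inequality needs measurable functions, so `f` is replaced by a version that almost
  -- surely agrees with it at all samples.
  set g : n → E → ℂ := fun i => (hf.aestronglyMeasurable i).mk (f i) with hg
  have hgm : ∀ i, Measurable (g i) := fun i =>
    (hf.aestronglyMeasurable i).stronglyMeasurable_mk.measurable
  have hfg : ∀ᵐ x ∂ν, ∀ i, f i x = g i x := by
    rw [ae_all_iff]
    exact fun i => (hf.aestronglyMeasurable i).ae_eq_mk
  have hG : IsBoundedOrthonormal ν g κ := by
    refine ⟨fun i => (hgm i).aestronglyMeasurable, ?_, fun i j => ?_⟩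
    · filter_upwards [hf.sum_sq_le, hfg] with x hx hx'
      simpa only [← hx'] using hx
    · rw [← hf.orthonormal i j]
      refine integral_congr_ae ?_
      filter_upwards [hfg] with x hx
      rw [hx i, hx j]
  have hlawpi : P.map (fun ω m => X m ω) = Measure.pi fun _ : Fin M => ν := by
    rw [(iIndepFun_iff_map_fun_eq_pi_map fun m => (hlaw m).aemeasurable).1 hX]
    simp only [(hlaw _).map_eq]
  have hXm : AEMeasurable (fun ω m => X m ω) P :=
    aemeasurable_pi_lambda _ fun m => (hlaw m).aemeasurable
  have hsame : ∀ᵐ ω ∂P, ∀ m i, f i (X m ω) = g i (X m ω) := by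
    rw [ae_all_iff]
    intro m
    have := hfg
    rw [← (hlaw m).map_eq] at this
    exact ae_of_ae_map (hlaw m).aemeasurable this
  have hNκ : (Fintype.card n : ℝ) ≤ κ := hf.card_le
  have hcard : 1 ≤ Fintype.card n := Fintype.card_pos
  have hκ : 1 ≤ κ := le_trans (by exact_mod_cast hcard) hNκ
  set S : Set (Fin M → E) := {x | ¬ ∀ c : n → ℂ,
        (1 - δ) * M * ∑ i, ‖c i‖ ^ 2 ≤ ∑ m, ‖∑ i, c i * g i (x m)‖ ^ 2} with hS
  calc P {ω | ¬ ∀ c : n → ℂ, (1 - δ) * M * ∑ i, ‖c i‖ ^ 2 ≤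
        ∑ m, ‖∑ i, c i * f i (X m ω)‖ ^ 2} ≤ P ((fun ω m => X m ω) ⁻¹' S) := by
        refine measure_mono_ae ?_
        filter_upwards [hsame] with ω hω hbad
        intro hgood
        exact hbad fun c => by simpa only [hω] using hgood c
    _ ≤ P.map (fun ω m => X m ω) S := Measure.le_map_apply hXm S
    _ = (Measure.pi fun _ : Fin M => ν) S := by rw [hlawpi]
    _ ≤ _ := (hG.measure_exists_sum_sq_lt_le hgm (s := (1 - δ) * M)
        (θ := 2 * δ / (3 * κ)) (by positivity) (chernoff_base_nonneg hκ hδ0 hδ1) M).trans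
        (ENNReal.ofReal_le_ofReal (chernoff_constant_le hcard hM hNκ hr hδ0 hδ1 h))

end Chernoff

/-! ### From coefficients to sup norms; the Christoffel weight. -/

theorem IsBoundedOrthonormal.integral_norm_sq_sum {n : Type*} [Fintype n] [DecidableEq n]
    {E : Type*} [MeasurableSpace E] {ν : Measure E} [IsProbabilityMeasure ν] {f : n → E → ℂ}
    {κ : ℝ} (hf : IsBoundedOrthonormal ν f κ) (c : n → ℂ) :
    ∫ x, ‖∑ i, c i * f i x‖ ^ 2 ∂ν = ∑ i, ‖c i‖ ^ 2 := by
  have h := (hf.integral_trace (outer (star c))).2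
  have h1 : ∀ x, (Matrix.trace (outer (fun i => f i x) * outer (star c))).re =
      ‖∑ i, c i * f i x‖ ^ 2 := fun x => by
    have := re_dotProduct_smul_outer 1 (fun i => f i x) c
    rw [Complex.ofReal_one, one_smul, one_mul] at this
    rw [Matrix.trace_mul_comm, trace_outer_mul, this]
  simp only [h1] at h
  rw [h, outer, Matrix.trace_vecMulVec, dotProduct, Complex.re_sum]
  refine Finset.sum_congr rfl fun i _ => ?_
  simp only [Pi.star_apply, RCLike.star_def, Complex.conj_conj, Complex.conj_mul',
    ← Complex.ofReal_pow, Complex.ofReal_re]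

theorem norm_sum_mul_sq_le {n : Type*} [Fintype n] (c y : n → ℂ) :
    ‖∑ i, c i * y i‖ ^ 2 ≤ (∑ i, ‖y i‖ ^ 2) * ∑ i, ‖c i‖ ^ 2 := by
  calc ‖∑ i, c i * y i‖ ^ 2 ≤ (∑ i, ‖y i‖ * ‖c i‖) ^ 2 := by
        gcongr
        refine (norm_sum_le _ _).trans_eq (Finset.sum_congr rfl fun i _ => ?_)
        rw [norm_mul, mul_comm]
    _ ≤ _ := Finset.sum_mul_sq_le_sq_mul_sq _ _ _

theorem le_sqrt_mul_of_sq_le {a b t : ℝ} (hb : 0 ≤ b) (ht : 0 ≤ t) (h : a ^ 2 ≤ b * t ^ 2) :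
    a ≤ Real.sqrt b * t := by
  have := Real.le_sqrt_of_sq_le h
  rwa [Real.sqrt_mul hb, Real.sqrt_sq ht] at this

section Mesh

variable {d N M : ℕ} {μ : Measure (EuclideanSpace ℝ (Fin d))}
  {v : Fin N → EuclideanSpace ℝ (Fin d) → ℂ}

theorem kernelDiag_nonneg (v : Fin N → EuclideanSpace ℝ (Fin d) → ℂ)
    (x : EuclideanSpace ℝ (Fin d)) : 0 ≤ kernelDiag v x :=
  Finset.sum_nonneg fun _ _ => by positivity

theorem kernelDiag_eq_zero_iff {x : EuclideanSpace ℝ (Fin d)} :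
    kernelDiag v x = 0 ↔ ∀ i, v i x = 0 := by
  rw [kernelDiag, Finset.sum_eq_zero_iff_of_nonneg fun _ _ => by positivity]
  simp

theorem christoffel_nonneg (v : Fin N → EuclideanSpace ℝ (Fin d) → ℂ)
    (x : EuclideanSpace ℝ (Fin d)) : 0 ≤ christoffel v x :=
  div_nonneg N.cast_nonneg (kernelDiag_nonneg v x)

theorem bernsteinMarkov_nonneg : 0 ≤ bernsteinMarkov μ v :=
  Real.iSup_nonneg fun _ => norm_nonneg _

theorem kernelDiag_le_bernsteinMarkov (hK : BddAbove (kernelDiag v '' μ.support))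
    {x : EuclideanSpace ℝ (Fin d)} (hx : x ∈ μ.support) :
    kernelDiag v x ≤ bernsteinMarkov μ v := by
  have hb : BddAbove (Set.range fun x : μ.support => ‖kernelDiag v x‖) := by
    obtain ⟨C, hC⟩ := hK
    refine ⟨C, ?_⟩
    rintro _ ⟨y, rfl⟩
    simp only [Real.norm_of_nonneg (kernelDiag_nonneg v y)]
    exact hC ⟨y, y.2, rfl⟩
  exact (le_abs_self _).trans (le_ciSup hb ⟨x, hx⟩)

theorem supNorm_le {f : EuclideanSpace ℝ (Fin d) → ℂ} {a : ℝ} (ha : 0 ≤ a)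
    (h : ∀ x ∈ μ.support, ‖f x‖ ≤ a) : supNorm μ f ≤ a :=
  Real.iSup_le (fun x => h x x.2) ha

theorem norm_le_discreteSupNorm (x : Fin M → EuclideanSpace ℝ (Fin d))
    (f : EuclideanSpace ℝ (Fin d) → ℂ) (m : Fin M) : ‖f (x m)‖ ≤ discreteSupNorm x f :=
  le_ciSup (f := fun m => ‖f (x m)‖) (Set.finite_range _).bddAbove m

theorem discreteSupNorm_nonneg (x : Fin M → EuclideanSpace ℝ (Fin d))
    (f : EuclideanSpace ℝ (Fin d) → ℂ) : 0 ≤ discreteSupNorm x f :=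
  Real.iSup_nonneg fun _ => norm_nonneg _

theorem le_of_mul_le_sum_sq (hM : 2 ≤ M) {δ s t : ℝ} (hδ : δ < 1)
    {f : EuclideanSpace ℝ (Fin d) → ℂ} {x : Fin M → EuclideanSpace ℝ (Fin d)}
    (hs : (1 - δ) * M * s ≤ ∑ m, ‖f (x m)‖ ^ 2) (ht : ∀ m, ‖f (x m)‖ ≤ t) :
    s ≤ t ^ 2 / (1 - δ) := by
  have h1 : ∑ m, ‖f (x m)‖ ^ 2 ≤ M * t ^ 2 := by
    calc _ ≤ ∑ _ : Fin M, t ^ 2 := Finset.sum_le_sum fun m _ => by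
          gcongr
          exact ht m
      _ = _ := by simp
  have hM0 : (0 : ℝ) < M := by
    have : 0 < M := by omega
    exact_mod_cast this
  rw [le_div_iff₀ (by linarith)]
  refine le_of_mul_le_mul_left ?_ hM0
  linarith

theorem IsOrthonormalBasis.exists_eq_sum {V : Submodule ℂ (EuclideanSpace ℝ (Fin d) → ℂ)}
    (hv : IsOrthonormalBasis μ V v) {u : EuclideanSpace ℝ (Fin d) → ℂ} (hu : u ∈ V) :
    ∃ c : Fin N → ℂ, ∀ x, u x = ∑ i, c i * v i x := by
  rw [← hv.span_eq, Submodule.mem_span_range_iff_exists_fun] at hu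
  obtain ⟨c, rfl⟩ := hu
  exact ⟨c, fun x => by simp⟩

theorem IsOrthonormalBasis.isBoundedOrthonormal
    {V : Submodule ℂ (EuclideanSpace ℝ (Fin d) → ℂ)} (hv : IsOrthonormalBasis μ V v)
    (hK : BddAbove (kernelDiag v '' μ.support)) :
    IsBoundedOrthonormal μ v (bernsteinMarkov μ v) where
  aestronglyMeasurable i := (hv.memLp i).1
  sum_sq_le := by
    filter_upwards [Measure.support_mem_ae (μ := μ)] with x hx
    exact kernelDiag_le_bernsteinMarkov hK hx
  orthonormal := hv.orthonormal

theorem norm_sq_sqrt_christoffel_mul (v : Fin N → EuclideanSpace ℝ (Fin d) → ℂ)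
    (x : EuclideanSpace ℝ (Fin d)) (z : ℂ) :
    ‖(Real.sqrt (christoffel v x) : ℂ) * z‖ ^ 2 = christoffel v x * ‖z‖ ^ 2 := by
  rw [norm_mul, mul_pow, Complex.norm_real, Real.norm_of_nonneg (Real.sqrt_nonneg _),
    Real.sq_sqrt (christoffel_nonneg v x)]

/-- The sum is exactly `N` where `K ≠ 0`. Where `K = 0` it is `0`, hence an inequality. -/
theorem sum_norm_sq_weighted_le (v : Fin N → EuclideanSpace ℝ (Fin d) → ℂ)
    (x : EuclideanSpace ℝ (Fin d)) :
    ∑ i, ‖(Real.sqrt (christoffel v x) : ℂ) * v i x‖ ^ 2 ≤ N := by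
  simp only [norm_sq_sqrt_christoffel_mul, ← Finset.mul_sum]
  change N / kernelDiag v x * kernelDiag v x ≤ N
  by_cases hx : kernelDiag v x = 0
  · simp [hx]
  · rw [div_mul_cancel₀ _ hx]

/-- The density `K/N` of `μ_V` cancels `λ = N/K` where `K ≠ 0`, and elsewhere all `v i` vanish, so
the inner products are those of the `v i` under `μ`. -/
theorem IsOrthonormalBasis.isBoundedOrthonormal_weighted (hN : 1 ≤ N)
    {V : Submodule ℂ (EuclideanSpace ℝ (Fin d) → ℂ)} (hv : IsOrthonormalBasis μ V v) :
    IsBoundedOrthonormal (inducedMeasure μ v)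
      (fun i x => (Real.sqrt (christoffel v x) : ℂ) * v i x) N := by
  have hNpos : (0 : ℝ) < N := by exact_mod_cast hN
  have hKm : AEMeasurable (kernelDiag v) μ := by
    refine Finset.aemeasurable_fun_sum _ fun i _ => ?_
    exact (hv.memLp i).1.norm.aemeasurable.pow_const 2
  have hac : inducedMeasure μ v ≪ μ := withDensity_absolutelyContinuous _ _
  refine ⟨fun i => ?_, Filter.Eventually.of_forall (sum_norm_sq_weighted_le v), fun i j => ?_⟩
  · refine AEStronglyMeasurable.mono_ac hac ?_
    refine AEStronglyMeasurable.mul ?_ (hv.memLp i).1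
    refine AEMeasurable.aestronglyMeasurable ?_
    exact Complex.measurable_ofReal.comp_aemeasurable
      (Real.continuous_sqrt.measurable.comp_aemeasurable (hKm.const_div _))
  · rw [inducedMeasure, integral_withDensity_eq_integral_toReal_smul₀
      (hKm.div_const _).ennreal_ofReal (by simp), ← hv.orthonormal i j]
    refine integral_congr_ae (Filter.Eventually.of_forall fun x => ?_)
    simp only
    rw [ENNReal.toReal_ofReal (div_nonneg (kernelDiag_nonneg v x) hNpos.le)]
    by_cases hx : kernelDiag v x = 0
    · simp [kernelDiag_eq_zero_iff.1 hx]
    · have h1 : (Real.sqrt (christoffel v x) : ℂ) * Real.sqrt (christoffel v x) =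
          (christoffel v x : ℂ) := by
        rw [← Complex.ofReal_mul, Real.mul_self_sqrt (christoffel_nonneg v x)]
      have h2 : ((kernelDiag v x / N : ℝ) : ℂ) * (christoffel v x : ℂ) = 1 := by
        rw [← Complex.ofReal_mul, christoffel, div_mul_div_cancel₀ hNpos.ne', div_self hx,
          Complex.ofReal_one]
      rw [Complex.real_smul, map_mul, Complex.conj_ofReal]
      calc _ = ((kernelDiag v x / N : ℝ) : ℂ) * ((Real.sqrt (christoffel v x) : ℂ) *
            Real.sqrt (christoffel v x)) * (v i x * (starRingEnd ℂ) (v j x)) := by ring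
        _ = _ := by rw [h1, h2, one_mul]

/-- If `V` contains a function that equals `1` on the support, then `K(x, x) ≥ 1` there. -/
theorem IsOrthonormalBasis.one_le_kernelDiag [IsProbabilityMeasure μ]
    {V : Submodule ℂ (EuclideanSpace ℝ (Fin d) → ℂ)} (hv : IsOrthonormalBasis μ V v)
    (hK : BddAbove (kernelDiag v '' μ.support)) (h1 : ∃ u ∈ V, ∀ x ∈ μ.support, u x = 1)
    {x : EuclideanSpace ℝ (Fin d)} (hx : x ∈ μ.support) : 1 ≤ kernelDiag v x := by
  obtain ⟨u, hu, hu1⟩ := h1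
  obtain ⟨c, hc⟩ := hv.exists_eq_sum hu
  -- As `μ` is a probability measure, the function equal to `1` has `‖c‖² = 1`; Cauchy–Schwarz at
  -- `x` then gives `1 ≤ K(x, x)`.
  have h := (hv.isBoundedOrthonormal hK).integral_norm_sq_sum c
  have h2 : ∫ x, ‖∑ i, c i * v i x‖ ^ 2 ∂μ = ∫ _, (1 : ℝ) ∂μ := by
    refine integral_congr_ae ?_
    filter_upwards [Measure.support_mem_ae (μ := μ)] with y hy
    rw [← hc, hu1 y hy]
    simp
  rw [h] at h2
  have h3 := norm_sum_mul_sq_le c (fun i => v i x)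
  rw [← hc, hu1 x hx, h2] at h3
  simpa [kernelDiag] using h3

end Mesh

end RandomMesh

/-! ### The three sampling inequalities. -/

theorem mainTheorem11 {d N M : ℕ} (hN : 1 ≤ N) (hM : 2 ≤ M)
    (μ : Measure (EuclideanSpace ℝ (Fin d))) [IsProbabilityMeasure μ]
    (V : Submodule ℂ (EuclideanSpace ℝ (Fin d) → ℂ))
    (v : Fin N → EuclideanSpace ℝ (Fin d) → ℂ)
    (hv : RandomMesh.IsOrthonormalBasis μ V v)
    (hK : BddAbove (RandomMesh.kernelDiag v '' μ.support))
    (r δ : ℝ) (hr : 0 < r) (hδ0 : 0 < δ) (hδ1 : δ < 1)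
    {Ω : Type*} [MeasurableSpace Ω] (P : Measure Ω) [IsProbabilityMeasure P]
    (X : Fin M → Ω → EuclideanSpace ℝ (Fin d)) (hX : iIndepFun X P) :
    -- samples from `μ`
    ((∀ m, HasLaw (X m) μ P) →
      3 * (1 + r) / δ ^ 2 * RandomMesh.bernsteinMarkov μ v ≤ (M : ℝ) / Real.log M →
      P.real {ω | ¬ ∀ u ∈ V, RandomMesh.supNorm μ u ≤
          Real.sqrt (RandomMesh.bernsteinMarkov μ v / (1 - δ)) *
            RandomMesh.discreteSupNorm (fun m => X m ω) u} ≤ 2 * (M : ℝ) ^ (-r)) ∧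
    -- samples from `μ_V`, weighted functions
    ((∀ m, HasLaw (X m) (RandomMesh.inducedMeasure μ v) P) →
      3 * (1 + r) / δ ^ 2 * (N : ℝ) ≤ (M : ℝ) / Real.log M →
      P.real {ω | ¬ ∀ w ∈ RandomMesh.weightedSpace V v, RandomMesh.supNorm μ w ≤
          Real.sqrt ((N : ℝ) / (1 - δ)) *
            RandomMesh.discreteSupNorm (fun m => X m ω) w} ≤ 2 * (M : ℝ) ^ (-r)) ∧
    -- samples from `μ_V`, unweighted functions, when `V` contains the constants
    ((∃ u ∈ V, ∀ x ∈ μ.support, u x = 1) →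
      (∀ m, HasLaw (X m) (RandomMesh.inducedMeasure μ v) P) →
      3 * (1 + r) / δ ^ 2 * (N : ℝ) ≤ (M : ℝ) / Real.log M →
      P.real {ω | ¬ ∀ u ∈ V, RandomMesh.supNorm μ u ≤
          Real.sqrt ((N : ℝ) * RandomMesh.bernsteinMarkov μ v / (1 - δ)) *
            RandomMesh.discreteSupNorm (fun m => X m ω) u} ≤ 2 * (M : ℝ) ^ (-r)) := by
  have : Nonempty (Fin N) := ⟨⟨0, hN⟩⟩
  have hδ : 0 < 1 - δ := by linarith
  have hNpos : (0 : ℝ) < N := by exact_mod_cast hN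
  have hκ := RandomMesh.bernsteinMarkov_nonneg (μ := μ) (v := v)
  have hMr : (0 : ℝ) ≤ (M : ℝ) ^ (-r) := by positivity
  -- The factor `2` is slack: only the lower tail of the Gram matrix enters, and it costs `M ^
  -- (-r)`.
  have hreal : ∀ S T : Set Ω, P T ≤ ENNReal.ofReal ((M : ℝ) ^ (-r)) → (∀ᵐ ω ∂P, ω ∈ S → ω ∈ T) →
      P.real S ≤ 2 * (M : ℝ) ^ (-r) := fun S T hT hST => by
    have h : P S ≤ P T := measure_mono_ae hST
    have := ENNReal.toReal_le_of_le_ofReal hMr (h.trans hT)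
    rw [measureReal_def]
    linarith
  have hprob : (∀ m, HasLaw (X m) (RandomMesh.inducedMeasure μ v) P) →
      IsProbabilityMeasure (RandomMesh.inducedMeasure μ v) := fun hlaw => by
    rw [← (hlaw ⟨0, by omega⟩).map_eq]
    exact Measure.isProbabilityMeasure_map (hlaw _).aemeasurable
  refine ⟨fun hlaw h => ?_, fun hlaw h => ?_, fun hone hlaw h => ?_⟩
  · refine hreal _ _ ((hv.isBoundedOrthonormal hK).measure_exists_sum_sq_sample_lt_le hM hr hδ0
      hδ1 h hX hlaw) (Filter.Eventually.of_forall fun ω => mt fun hgood u hu => ?_)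
    obtain ⟨c, hc⟩ := hv.exists_eq_sum hu
    have hs := hgood c
    simp only [← hc] at hs
    have ht := RandomMesh.discreteSupNorm_nonneg (fun m => X m ω) u
    have hsle := RandomMesh.le_of_mul_le_sum_sq (x := fun m => X m ω) hM hδ1 hs
      (RandomMesh.norm_le_discreteSupNorm _ u)
    refine RandomMesh.supNorm_le (by positivity) fun x hx => ?_
    refine RandomMesh.le_sqrt_mul_of_sq_le (by positivity) ht ?_
    calc ‖u x‖ ^ 2 ≤ RandomMesh.kernelDiag v x * ∑ i, ‖c i‖ ^ 2 := by
          rw [hc]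
          exact RandomMesh.norm_sum_mul_sq_le c fun i => v i x
      _ ≤ RandomMesh.bernsteinMarkov μ v *
          (RandomMesh.discreteSupNorm (fun m => X m ω) u ^ 2 / (1 - δ)) := by
          gcongr
          exact RandomMesh.kernelDiag_le_bernsteinMarkov hK hx
      _ = _ := by ring
  · have := hprob hlaw
    refine hreal _ _ ((hv.isBoundedOrthonormal_weighted hN).measure_exists_sum_sq_sample_lt_le hM
      hr hδ0 hδ1 h hX hlaw) (Filter.Eventually.of_forall fun ω => mt ?_)
    rintro hgood w ⟨u, hu, rfl⟩
    obtain ⟨c, hc⟩ := hv.exists_eq_sum hu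
    have hw : ∀ x, ∑ i, c i * ((Real.sqrt (RandomMesh.christoffel v x) : ℂ) * v i x) =
        (Real.sqrt (RandomMesh.christoffel v x) : ℂ) * u x := fun x => by
      rw [hc, Finset.mul_sum]
      exact Finset.sum_congr rfl fun i _ => by ring
    have hs := hgood c
    simp only [hw] at hs
    have ht := RandomMesh.discreteSupNorm_nonneg (fun m => X m ω)
      fun x => (Real.sqrt (RandomMesh.christoffel v x) : ℂ) * u x
    have hsle := RandomMesh.le_of_mul_le_sum_sq (x := fun m => X m ω)
      (f := fun x => (Real.sqrt (RandomMesh.christoffel v x) : ℂ) * u x) hM hδ1 hs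
      (RandomMesh.norm_le_discreteSupNorm (fun m => X m ω)
        fun x => (Real.sqrt (RandomMesh.christoffel v x) : ℂ) * u x)
    generalize RandomMesh.discreteSupNorm (fun m => X m ω)
      (fun x => (Real.sqrt (RandomMesh.christoffel v x) : ℂ) * u x) = t at ht hsle ⊢
    refine RandomMesh.supNorm_le (by positivity) fun x _ => ?_
    refine RandomMesh.le_sqrt_mul_of_sq_le (by positivity) ht ?_
    rw [← hw x]
    refine (RandomMesh.norm_sum_mul_sq_le c _).trans ?_
    calc _ ≤ (N : ℝ) * (t ^ 2 / (1 - δ)) :=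
          mul_le_mul (RandomMesh.sum_norm_sq_weighted_le v x) hsle
            (Finset.sum_nonneg fun _ _ => by positivity) hNpos.le
      _ = _ := by ring
  · have := hprob hlaw
    -- The bound `K ≥ 1` is known only on the support, so the samples must be placed there almost
    -- surely.
    have hD : ∀ᵐ ω ∂P, ∀ m, X m ω ∈ μ.support := by
      rw [ae_all_iff]
      intro m
      have h1 : ∀ᵐ x ∂P.map (X m), x ∈ μ.support := by
        rw [(hlaw m).map_eq]
        exact (withDensity_absolutelyContinuous _ _).ae_le Measure.support_mem_ae
      exact ae_of_ae_map (hlaw m).aemeasurable h1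
    refine hreal _ _ ((hv.isBoundedOrthonormal_weighted hN).measure_exists_sum_sq_sample_lt_le hM
      hr hδ0 hδ1 h hX hlaw) (hD.mono fun ω hω => mt fun hgood u hu => ?_)
    obtain ⟨c, hc⟩ := hv.exists_eq_sum hu
    have hw : ∀ x, ∑ i, c i * ((Real.sqrt (RandomMesh.christoffel v x) : ℂ) * v i x) =
        (Real.sqrt (RandomMesh.christoffel v x) : ℂ) * u x := fun x => by
      rw [hc, Finset.mul_sum]
      exact Finset.sum_congr rfl fun i _ => by ring
    have hs := hgood c
    simp only [hw] at hs
    have ht := RandomMesh.discreteSupNorm_nonneg (fun m => X m ω) u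
    -- Removing the weight at the samples costs `√N`; the factor `K_μ(V)` comes from bounding `u`
    -- itself by its coefficients.
    have hle : ∀ m, ‖(Real.sqrt (RandomMesh.christoffel v (X m ω)) : ℂ) * u (X m ω)‖ ≤
        Real.sqrt N * RandomMesh.discreteSupNorm (fun m => X m ω) u := fun m => by
      refine RandomMesh.le_sqrt_mul_of_sq_le hNpos.le ht ?_
      rw [RandomMesh.norm_sq_sqrt_christoffel_mul]
      gcongr
      · exact div_le_self hNpos.le (hv.one_le_kernelDiag hK hone (hω m))
      · exact RandomMesh.norm_le_discreteSupNorm (fun m => X m ω) u m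
    have hsle := RandomMesh.le_of_mul_le_sum_sq (x := fun m => X m ω)
      (f := fun x => (Real.sqrt (RandomMesh.christoffel v x) : ℂ) * u x) hM hδ1 hs hle
    refine RandomMesh.supNorm_le (by positivity) fun x hx => ?_
    refine RandomMesh.le_sqrt_mul_of_sq_le (by positivity) ht ?_
    calc ‖u x‖ ^ 2 ≤ RandomMesh.kernelDiag v x * ∑ i, ‖c i‖ ^ 2 := by
          rw [hc]
          exact RandomMesh.norm_sum_mul_sq_le c fun i => v i x
      _ ≤ RandomMesh.bernsteinMarkov μ v *
          ((Real.sqrt N * RandomMesh.discreteSupNorm (fun m => X m ω) u) ^ 2 / (1 - δ)) := by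
          gcongr
          exact RandomMesh.kernelDiag_le_bernsteinMarkov hK hx
      _ = _ := by
          rw [mul_pow, Real.sq_sqrt hNpos.le]
          ring
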